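/- Let $M=(V,\delta)$ be a finite metric space with $n=|V|\ge 1$ points, and let $r:V\to\mathbb{R}^+$ be a range assignment (a non-negative real $r(v)$ for each $v \in V$). The symmetric disk graph $SDG(M,r)$ is the undirected graph on $V$ in which distinct points $u,v$ are joined by an edge if and only if $\delta(u,v)\le r(u)$ and $\delta(u,v)\le r(v)$. Give each edge $(u,v)$ the weight $\delta(u,v)$, and let the weight $w(G)$ of a graph $G$ on $V$ be the sum of the weights of its edges. A spanning forest of a graph $G$ is an acyclic subgraph on all vertices of $G$ that has the same connected components as $G$; a minimum spanning forest (MSF) is one of least weight. A minimum spanning tree $MST(M)$ of $M$ is a least-weight spanning tree of the complete graph on $V$. Then, whether or not $SDG(M,r)$ is connected, every minimum spanning forest $MSF(SDG(M,r))$ and every minimum spanning tree $MST(M)$ satisfy $$w(MSF(SDG(M,r)))\;\le\; 2\log_{5/4} n\cdot w(MST(M)).$$ In particular, $w(MSF(SDG(M,r))) = O(\log n)\cdot w(MST(M))$, with an absolute implied constant. -/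

import Mathlib

namespace MetricMSF

/-- The weight `w(e) = δ(u, v)` of an edge `e = (u, v)` of the complete graph on a metric. -/
noncomputable def edgeWeight (V : Type*) [MetricSpace V] : Sym2 V → ℝ :=
  Sym2.lift ⟨fun u v => dist u v, fun u v => dist_comm u v⟩

open Classical in
/-- The weight of a graph: the sum of the weights of its edges. -/
noncomputable def graphWeight {V : Type*} [Fintype V] (w : Sym2 V → ℝ) (G : SimpleGraph V) : ℝ :=
  ∑ e ∈ G.edgeFinset, w e

/-- The symmetric disk graph of a metric and a range assignment `r`: distinct points `u`, `v` are
joined exactly when both `r u` and `r v` are no smaller than `δ(u, v)`. -/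
def sdg {V : Type*} [MetricSpace V] (r : V → ℝ) : SimpleGraph V where
  Adj u v := u ≠ v ∧ dist u v ≤ r u ∧ dist u v ≤ r v
  symm := ⟨fun u v h => ⟨h.1.symm, by rw [dist_comm]; exact h.2.2, by rw [dist_comm]; exact h.2.1⟩⟩
  loopless := ⟨fun _ h => h.1 rfl⟩

/-- `F` is a spanning forest of `G`: an acyclic subgraph on all the vertices, with the same
connected components as `G`. -/
def IsSpanningForest {V : Type*} (G F : SimpleGraph V) : Prop :=
  F ≤ G ∧ F.IsAcyclic ∧ ∀ u v, F.Reachable u v ↔ G.Reachable u v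

/-- `F` is a minimum spanning forest of the graph `G` with edge weights `w`. -/
def IsMSF {V : Type*} [Fintype V] (w : Sym2 V → ℝ) (G F : SimpleGraph V) : Prop :=
  IsSpanningForest G F ∧ ∀ F', IsSpanningForest G F' → graphWeight w F ≤ graphWeight w F'

/-- `T` is a spanning tree of `G`. -/
def IsSpanningTree {V : Type*} (G T : SimpleGraph V) : Prop :=
  T ≤ G ∧ T.IsTree

/-- `T` is a minimum spanning tree of the graph `G` with edge weights `w`. -/
def IsMST {V : Type*} [Fintype V] (w : Sym2 V → ℝ) (G T : SimpleGraph V) : Prop :=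
  IsSpanningTree G T ∧ ∀ T', IsSpanningTree G T' → graphWeight w T ≤ graphWeight w T'

/-- Every finite weighted graph, connected or not, has a minimum spanning forest. -/
theorem exists_isMSF {V : Type*} [Fintype V] (w : Sym2 V → ℝ) (G : SimpleGraph V) :
    ∃ F, IsMSF w G F := by
  obtain ⟨F, -, hF⟩ := SimpleGraph.exists_maximal_isAcyclic_of_le_isAcyclic
    (G := G) (H := ⊥) bot_le SimpleGraph.isAcyclic_bot
  have h := SimpleGraph.reachable_eq_of_maximal_isAcyclic F hF
  have hne : {F | IsSpanningForest G F}.Nonempty :=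
    ⟨F, hF.prop.1, hF.prop.2, fun u v => by rw [h]⟩
  obtain ⟨F₀, h₁, h₂⟩ := Set.exists_min_image _ (graphWeight w) (Set.toFinite _) hne
  exact ⟨F₀, h₁, h₂⟩

/-- Every finite connected weighted graph has a minimum spanning tree. -/
theorem exists_isMST {V : Type*} [Fintype V] (w : Sym2 V → ℝ) (G : SimpleGraph V)
    (hG : G.Connected) : ∃ T, IsMST w G T := by
  obtain ⟨T, hle, hT⟩ := hG.exists_isTree_le
  have hne : {T | IsSpanningTree G T}.Nonempty := ⟨T, hle, hT⟩
  obtain ⟨T₀, h₁, h₂⟩ := Set.exists_min_image _ (graphWeight w) (Set.toFinite _) hne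
  exact ⟨T₀, h₁, h₂⟩

end MetricMSF

namespace MetricMSF

open SimpleGraph

/-! Fix `t`, and let `k` forest edges weigh at least `t`. Their endpoints have range at least `t`,
so two of them closer than `t` are adjacent in the disk graph, and by the exchange property the
forest joins them by edges lighter than `t`. Deleting the `k` heavy edges leaves `k + 1` of these
endpoints pairwise disconnected, hence `t`-separated (`exists_separated_of_isMSF_sdg`). Disjoint
balls of radius `t / 2` around them force any connected graph to weigh at least `(k + 1) * t / 2`
(`card_mul_le_graphWeight`). So the `i`-th heaviest forest edge weighs at most `2 w(T) / (i + 1)`,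
and the harmonic sum is at most `2 w(T) log n`. -/

lemma edgeWeight_nonneg {V : Type*} [MetricSpace V] (e : Sym2 V) : 0 ≤ edgeWeight V e := by
  induction e with | h u v => exact dist_nonneg

/-! ### Harmonic summation -/

/-- If the weight of every element times one more than its rank from the top is at most `C`, the
total weight is at most `C` times a logarithm of the number of elements. -/
lemma sum_le_mul_log_card {ι : Type*} (w : ι → ℝ) {C : ℝ} (hC : 0 ≤ C) (s : Finset ι)
    (h : ∀ e ∈ s, w e * ((s.filter fun e' => w e ≤ w e').card + 1 : ℝ) ≤ C) (hw : ∀ e ∈ s, 0 ≤ w e) :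
    ∑ e ∈ s, w e ≤ C * Real.log (s.card + 1) := by
  classical
  induction hn : s.card generalizing s with
  | zero => simp [Finset.card_eq_zero.mp hn]
  | succ n ih =>
    -- The lightest element has all of `s` above it, so `w e ≤ C / (n + 2)`; erasing it only lowers
    -- the other ranks.
    obtain ⟨e, he, hmin⟩ := s.exists_min_image w (Finset.card_pos.mp (by omega))
    have hcard : (s.erase e).card = n := by rw [Finset.card_erase_of_mem he, hn]; rfl
    have hrest := ih (s.erase e) (fun a ha => by
      refine le_trans ?_ (h a (Finset.mem_of_mem_erase ha))
      have := hw a (Finset.mem_of_mem_erase ha)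
      gcongr
      exact Finset.erase_subset _ _) (fun a ha => hw a (Finset.mem_of_mem_erase ha)) hcard
    have hfe := h e he
    rw [Finset.filter_true_of_mem hmin, hn] at hfe
    push_cast at hfe ⊢
    have hn0 : (0 : ℝ) ≤ n := n.cast_nonneg
    -- `1 - 1 / x ≤ log x` gives `1 / (n + 2) ≤ log (n + 2) - log (n + 1)`, which telescopes.
    have hlog := Real.one_sub_inv_le_log_of_pos (x := ((n : ℝ) + 1 + 1) / (n + 1)) (by positivity)
    rw [Real.log_div (by positivity) (by positivity), inv_div,
      one_sub_div (by positivity), add_sub_cancel_left] at hlog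
    have hle : w e ≤ C * (1 / ((n : ℝ) + 1 + 1)) := by
      rw [mul_one_div, le_div_iff₀ (by positivity)]
      exact hfe
    rw [← Finset.add_sum_erase s w he]
    nlinarith [mul_le_mul_of_nonneg_left hlog hC]

/-! ### Packing bound for connected graphs -/

/-- Along a walk, a function on the vertices grows by at most the sum of its increments. -/
lemma sub_le_sum_edges {V : Type*} {G : SimpleGraph V} (f : V → ℝ) (g : Sym2 V → ℝ)
    (hg : ∀ u v, f u - f v ≤ g s(u, v)) {u v : V} (p : G.Walk u v) :
    f u - f v ≤ (p.edges.map g).sum := by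
  induction p with
  | nil => simp
  | @cons a b c h p ih =>
    simp only [Walk.edges_cons, List.map_cons, List.sum_cons]
    linarith [hg a b]

/-- The tent functions of radius `t / 2` around `t`-separated points jointly vary by at most the
distance. -/
lemma sum_abs_tent_sub_le {V : Type*} [MetricSpace V] {t : ℝ} (N : Finset V)
    (hN : ∀ x ∈ N, ∀ y ∈ N, x ≠ y → t ≤ dist x y) (u v : V) :
    ∑ x ∈ N, |max 0 (t / 2 - dist x u) - max 0 (t / 2 - dist x v)| ≤ dist u v := by
  classical
  have tri (x : V) : dist x u ≤ dist x v + dist u v := dist_comm u v ▸ dist_triangle x v u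
  have tri' (x : V) : dist x v ≤ dist x u + dist u v := dist_triangle x u v
  have single (x : V) : |max 0 (t / 2 - dist x u) - max 0 (t / 2 - dist x v)| ≤ dist u v := by
    have := abs_max_sub_max_le_abs (t / 2 - dist x u) (t / 2 - dist x v) 0
    rw [max_comm, max_comm _ (0 : ℝ)] at this
    refine this.trans ?_
    rw [abs_le]
    constructor <;> linarith [tri x, tri' x]
  -- The open balls of radius `t / 2` are disjoint, so at most one tent is nonzero at `u` and at
  -- most one at `v`.
  have unique (a x y : V) (hx : x ∈ N) (hy : y ∈ N) (hxa : dist x a < t / 2)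
      (hya : dist y a < t / 2) : x = y := by
    by_contra hne
    linarith [hN x hx y hy hne, dist_triangle_right x y a]
  by_cases hu : ∃ x ∈ N, dist x u < t / 2
  · obtain ⟨x, hx, hxu⟩ := hu
    by_cases hv : ∃ y ∈ N, dist y v < t / 2
    · obtain ⟨y, hy, hyv⟩ := hv
      by_cases hxy : x = y
      · subst hxy
        rw [Finset.sum_eq_single_of_mem x hx]
        · exact single x
        · intro z hz hzx
          have h₁ : t / 2 ≤ dist z u := not_lt.mp fun h => hzx (unique u z x hz hx h hxu)
          have h₂ : t / 2 ≤ dist z v := not_lt.mp fun h => hzx (unique v z x hz hx h hyv)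
          simp [max_eq_left (sub_nonpos.mpr h₁), max_eq_left (sub_nonpos.mpr h₂)]
      · rw [← Finset.sum_subset (s₁ := {x, y}) (by grind)]
        · have h₁ : t / 2 ≤ dist x v := not_lt.mp fun h => hxy (unique v x y hx hy h hyv)
          have h₂ : t / 2 ≤ dist y u := not_lt.mp fun h => hxy (unique u x y hx hy hxu h)
          rw [Finset.sum_pair hxy, max_eq_left (sub_nonpos.mpr h₁),
            max_eq_left (sub_nonpos.mpr h₂), max_eq_right (sub_nonneg.mpr hxu.le),
            max_eq_right (sub_nonneg.mpr hyv.le), sub_zero, zero_sub, abs_neg,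
            abs_of_nonneg (sub_nonneg.mpr hxu.le), abs_of_nonneg (sub_nonneg.mpr hyv.le)]
          have := hN x hx y hy hxy
          have := dist_triangle x u y
          have := dist_triangle u v y
          rw [dist_comm v y] at this
          linarith
        · intro z hz hzxy
          simp only [Finset.mem_insert, Finset.mem_singleton, not_or] at hzxy
          have h₁ : t / 2 ≤ dist z u := not_lt.mp fun h => hzxy.1 (unique u z x hz hx h hxu)
          have h₂ : t / 2 ≤ dist z v := not_lt.mp fun h => hzxy.2 (unique v z y hz hy h hyv)
          simp [max_eq_left (sub_nonpos.mpr h₁), max_eq_left (sub_nonpos.mpr h₂)]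
    · push Not at hv
      rw [Finset.sum_eq_single_of_mem x hx]
      · exact single x
      · intro z hz hzx
        have h₁ : t / 2 ≤ dist z u := not_lt.mp fun h => hzx (unique u z x hz hx h hxu)
        simp [max_eq_left (sub_nonpos.mpr h₁), max_eq_left (sub_nonpos.mpr (hv z hz))]
  · push Not at hu
    by_cases hv : ∃ y ∈ N, dist y v < t / 2
    · obtain ⟨y, hy, hyv⟩ := hv
      rw [Finset.sum_eq_single_of_mem y hy]
      · exact single y
      · intro z hz hzy
        have h₂ : t / 2 ≤ dist z v := not_lt.mp fun h => hzy (unique v z y hz hy h hyv)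
        simp [max_eq_left (sub_nonpos.mpr h₂), max_eq_left (sub_nonpos.mpr (hu z hz))]
    · push Not at hv
      rw [Finset.sum_eq_zero]
      · exact dist_nonneg
      · intro z hz
        simp [max_eq_left (sub_nonpos.mpr (hu z hz)), max_eq_left (sub_nonpos.mpr (hv z hz))]

/-- A connected graph on a metric that contains at least two `t`-separated points weighs at least
`t / 2` for each of them. -/
lemma card_mul_le_graphWeight {V : Type*} [Fintype V] [MetricSpace V] {T : SimpleGraph V}
    (hT : T.Connected) {t : ℝ} (ht : 0 ≤ t) (N : Finset V)
    (hN : ∀ x ∈ N, ∀ y ∈ N, x ≠ y → t ≤ dist x y) (hcard : 1 < N.card) :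
    (N.card : ℝ) * (t / 2) ≤ graphWeight (edgeWeight V) T := by
  classical
  let f : V → V → ℝ := fun x v => max 0 (t / 2 - dist x v)
  let g : V → Sym2 V → ℝ := fun x =>
    Sym2.lift ⟨fun u v => |f x u - f x v|, fun u v => abs_sub_comm _ _⟩
  have hg0 (x : V) (e : Sym2 V) : 0 ≤ g x e := by
    induction e with | h u v => exact abs_nonneg _
  have hvertex (x : V) (hx : x ∈ N) : t / 2 ≤ ∑ e ∈ T.edgeFinset, g x e := by
    -- A second separated point is where the tent at `x` has dropped from `t / 2` to `0`.
    obtain ⟨y, hy, hyx⟩ := Finset.exists_mem_ne hcard x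
    obtain ⟨p, hp⟩ := hT.exists_isPath x y
    have h := sub_le_sum_edges (f x) (g x) (fun u v => le_abs_self _) p
    have hfx : f x x = t / 2 := by
      simpa [f] using by linarith
    have hfy : f x y = 0 := by
      have := hN x hx y hy hyx.symm
      exact max_eq_left (by linarith)
    rw [hfx, hfy, sub_zero, ← List.sum_toFinset _ hp.isTrail.edges_nodup] at h
    refine h.trans (Finset.sum_le_sum_of_subset_of_nonneg ?_ fun e _ _ => hg0 x e)
    intro e he
    exact mem_edgeFinset.mpr (p.edges_subset_edgeSet (List.mem_toFinset.mp he))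
  calc (N.card : ℝ) * (t / 2) = ∑ x ∈ N, t / 2 := by simp
    _ ≤ ∑ x ∈ N, ∑ e ∈ T.edgeFinset, g x e := Finset.sum_le_sum hvertex
    _ = ∑ e ∈ T.edgeFinset, ∑ x ∈ N, g x e := Finset.sum_comm
    _ ≤ ∑ e ∈ T.edgeFinset, edgeWeight V e := by
      refine Finset.sum_le_sum fun e _ => ?_
      induction e with | h u v => exact sum_abs_tent_sub_le N hN u v
    _ = graphWeight (edgeWeight V) T := by
      unfold graphWeight
      congr!

/-! ### Spanning forests and edge exchange -/

/-- Deleting `k` edges from a forest separates some `k + 1` of their endpoints from each other. -/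
lemma exists_separated_endpoints {V : Type*} {F : SimpleGraph V} (hF : F.IsAcyclic) {S : Set V}
    (hS : S.Nonempty) (A : Finset (Sym2 V)) (hA : ∀ e ∈ A, e ∈ F.edgeSet)
    (hAS : ∀ e ∈ A, ∀ v ∈ e, v ∈ S) :
    ∃ N : Finset V, ↑N ⊆ S ∧ N.card = A.card + 1 ∧
      ∀ x ∈ N, ∀ y ∈ N, (F.deleteEdges (A : Set (Sym2 V))).Reachable x y → x = y := by
  classical
  induction A using Finset.induction_on with
  | empty =>
    obtain ⟨x, hx⟩ := hS
    exact ⟨{x}, by simpa using hx, by simp, by simp⟩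
  | @insert e A he ih =>
    obtain ⟨N, hNS, hcard, hN⟩ := ih (fun e' h => hA e' (Finset.mem_insert_of_mem h))
      (fun e' h => hAS e' (Finset.mem_insert_of_mem h))
    induction e with | h u v => ?_
    have hle : F.deleteEdges ↑(insert s(u, v) A) ≤ F.deleteEdges (A : Set (Sym2 V)) :=
      deleteEdges_anti (by simp)
    have hadj : (F.deleteEdges (A : Set (Sym2 V))).Adj u v := by
      rw [deleteEdges_adj]
      exact ⟨hA _ (Finset.mem_insert_self _ _), by simpa using he⟩
    have hbridge : ¬ (F.deleteEdges ↑(insert s(u, v) A)).Reachable u v := by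
      have h := isAcyclic_iff_forall_isBridge.mp hF (hA _ (Finset.mem_insert_self _ _))
      rw [isBridge_iff] at h
      exact fun h' => h (h'.mono (deleteEdges_anti (by simp)))
    obtain ⟨z, hzS, hz⟩ : ∃ z ∈ S, ∀ x ∈ N,
        ¬ (F.deleteEdges ↑(insert s(u, v) A)).Reachable x z := by
      -- If `N` still reached both `u` and `v`, it would do so from a single point, bypassing the
      -- bridge `s(u, v)`.
      by_contra! hcon
      obtain ⟨x, hx, hxu⟩ := hcon u (hAS _ (Finset.mem_insert_self _ _) u (by simp))
      obtain ⟨y, hy, hyv⟩ := hcon v (hAS _ (Finset.mem_insert_self _ _) v (by simp))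
      obtain rfl := hN x hx y hy
        (((hxu.mono hle).trans hadj.reachable).trans (hyv.mono hle).symm)
      exact hbridge (hxu.symm.trans hyv)
    have hzN : z ∉ N := fun h => hz z h (Reachable.refl z)
    refine ⟨insert z N, ?_, ?_, ?_⟩
    · rw [Finset.coe_insert]
      exact Set.insert_subset hzS hNS
    · rw [Finset.card_insert_of_notMem hzN, Finset.card_insert_of_notMem he, hcard]
    · intro x hx y hy hxy
      rcases Finset.mem_insert.mp hx with hxz | hxN <;>
        rcases Finset.mem_insert.mp hy with hyz | hyN
      · rw [hxz, hyz]
      · exact (hz y hyN (hxz ▸ hxy.symm)).elim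
      · exact (hz x hxN (hyz ▸ hxy)).elim
      · exact hN x hxN y hyN (hxy.mono hle)

/-- Exchanging an edge of a spanning forest for an edge that reconnects its two sides. -/
lemma IsSpanningForest.exchange {V : Type*} {G F : SimpleGraph V} (hF : IsSpanningForest G F)
    {x y : V} (hxy : G.Adj x y) {e : Sym2 V} (hne : s(x, y) ≠ e)
    (hsep : ¬ (F.deleteEdges {e}).Reachable x y) :
    IsSpanningForest G (F.deleteEdges {e} ⊔ edge x y) := by
  classical
  obtain ⟨hFG, hac, hreach⟩ := hF
  have hle : F.deleteEdges {e} ⊔ edge x y ≤ G :=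
    sup_le ((deleteEdges_le _).trans hFG) <| fun a b h => by
      rcases (edge_adj ..).mp h with ⟨⟨rfl, rfl⟩ | ⟨rfl, rfl⟩, -⟩
      exacts [hxy, hxy.symm]
  refine ⟨hle, (hac.anti (deleteEdges_le _)).sup_edge_of_not_reachable hsep, fun u v =>
    ⟨fun h => h.mono hle, fun h => ?_⟩⟩
  obtain ⟨p, hp⟩ := ((hreach x y).mpr hxy.reachable).exists_isPath
  obtain ⟨e', rfl, hep⟩ := p.exists_mem_edges_of_not_reachable_deleteEdges hsep
  have hxyF : ¬ F.Adj x y := fun h => hsep (Adj.reachable (by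
    rw [deleteEdges_adj]; exact ⟨h, by simpa using hne⟩))
  have hK : (F ⊔ edge x y).deleteEdges {e'} ≤ F.deleteEdges {e'} ⊔ edge x y := by
    intro a b
    simp only [deleteEdges_adj, sup_adj]
    tauto
  -- The edge `e'` lies on the cycle closed by `p` and `s(x, y)`, so its ends stay connected without
  -- it.
  have hadj {a b : V} (hab : F.Adj a b) : (F.deleteEdges {e'} ⊔ edge x y).Reachable a b := by
    by_cases he : s(a, b) = e'
    · subst he
      refine Reachable.mono hK ?_
      refine (adj_and_reachable_delete_edges_iff_exists_cycle.mpr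
        ⟨y, .cons (v := x) ?_ (p.mapLe le_sup_left), ?_, ?_⟩).2
      · simp [edge_adj, hxy.ne']
      · refine Path.cons_isCycle ⟨_, hp.mapLe le_sup_left⟩ _ ?_
        simp only [Walk.edges_mapLe_eq_edges]
        exact fun h => hxyF (p.adj_of_mem_edges h).symm
      · simp [hep]
    · exact Adj.reachable (Or.inl (by rw [deleteEdges_adj]; exact ⟨hab, by simpa using he⟩))
  obtain ⟨q⟩ := (hreach u v).mpr h
  clear h
  induction q with
  | nil => exact Reachable.refl _
  | cons h q ih => exact (hadj h).trans ih

/-- The edges of a minimum spanning forest below a threshold connect the endpoints of every edge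
below it. -/
lemma IsMSF.reachable_deleteEdges {V : Type*} [Fintype V] {w : Sym2 V → ℝ} {G F : SimpleGraph V}
    (hF : IsMSF w G F) {t : ℝ} {x y : V} (hxy : G.Adj x y) (hw : w s(x, y) < t) :
    (F.deleteEdges {e | t ≤ w e}).Reachable x y := by
  classical
  by_contra hsep
  obtain ⟨p, hp⟩ := ((hF.1.2.2 x y).mpr hxy.reachable).exists_isPath
  obtain ⟨e, hte, hep⟩ := p.exists_mem_edges_of_not_reachable_deleteEdges hsep
  have hne : s(x, y) ≠ e := by
    rintro rfl
    exact absurd hw (not_lt.mpr hte)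
  -- Paths in a forest are unique, so every walk from `x` to `y` uses `e`.
  have hsep' : ¬ (F.deleteEdges {e}).Reachable x y := by
    induction e with | h a b => ?_
    rw [reachable_deleteEdges_iff_exists_walk]
    rintro ⟨q, hq⟩
    have := congrArg Subtype.val ((hF.1.2.1.subsingleton_path x y).elim ⟨p, hp⟩ q.toPath)
    exact hq (Walk.edges_toPath_subset_edges q (this ▸ hep))
  have hmin := hF.2 _ (hF.1.exchange hxy hne hsep')
  have heF : e ∈ F.edgeFinset := mem_edgeFinset.mpr (p.edges_subset_edgeSet hep)
  have hnadj : ¬ (F.deleteEdges {e}).Adj x y := fun h => hsep' h.reachable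
  have hset : (F.deleteEdges {e} ⊔ edge x y).edgeFinset
      = insert s(x, y) (F.edgeFinset.erase e) := by
    ext e'
    simp only [mem_edgeFinset, edgeSet_sup, edgeSet_deleteEdges, edgeSet_edge_of_ne hxy.ne,
      Finset.mem_insert, Finset.mem_erase, Set.mem_union, Set.mem_sdiff, Set.mem_singleton_iff]
    tauto
  have hnot : s(x, y) ∉ F.edgeFinset.erase e := by
    intro h
    rw [Finset.mem_erase, mem_edgeFinset] at h
    exact hnadj (by rw [deleteEdges_adj]; exact ⟨h.2, by simpa using h.1⟩)
  have hwt : graphWeight w (F.deleteEdges {e} ⊔ edge x y)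
      = w s(x, y) + ∑ e' ∈ F.edgeFinset.erase e, w e' := by
    rw [← Finset.sum_insert hnot, ← hset]
    unfold graphWeight
    congr!
  have hwF : graphWeight w F = w e + ∑ e' ∈ F.edgeFinset.erase e, w e' := by
    rw [Finset.add_sum_erase _ _ heF]
    unfold graphWeight
    congr!
  rw [hwt, hwF] at hmin
  have : t ≤ w e := hte
  linarith

/-! ### Disk graphs and the logarithmic bound -/

open Classical in
/-- A minimum spanning forest of a symmetric disk graph with `k` edges of weight at least `t`
forces `k + 1` points at mutual distance at least `t`. -/
lemma exists_separated_of_isMSF_sdg {V : Type*} [Fintype V] [MetricSpace V] {r : V → ℝ}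
    {F : SimpleGraph V} (hF : IsMSF (edgeWeight V) (sdg r) F) {t : ℝ}
    (hS : ∃ v, t ≤ r v) :
    ∃ N : Finset V, N.card = (F.edgeFinset.filter fun e => t ≤ edgeWeight V e).card + 1 ∧
      ∀ x ∈ N, ∀ y ∈ N, x ≠ y → t ≤ dist x y := by
  obtain ⟨N, hNS, hcard, hN⟩ := exists_separated_endpoints hF.1.2.1 (S := {v | t ≤ r v}) hS
    (F.edgeFinset.filter fun e => t ≤ edgeWeight V e)
    (fun e he => mem_edgeFinset.mp (Finset.mem_filter.mp he).1) (by
      intro e he z hz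
      rw [Finset.mem_filter, mem_edgeFinset] at he
      induction e with | h a b => ?_
      obtain ⟨-, ha, hb⟩ := hF.1.1 he.1
      have ht : t ≤ dist a b := he.2
      rcases Sym2.mem_iff.mp hz with rfl | rfl
      · exact ht.trans ha
      · exact ht.trans hb)
  refine ⟨N, hcard, fun x hx y hy hxy => not_lt.mp fun hlt => hxy (hN x hx y hy ?_)⟩
  have hadj : (sdg r).Adj x y := ⟨hxy, hlt.le.trans (hNS hx), hlt.le.trans (hNS hy)⟩
  refine (hF.reachable_deleteEdges hadj hlt).mono fun a b => ?_
  simp only [deleteEdges_adj, Finset.coe_filter, Set.mem_ofPred_eq, mem_edgeFinset]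
  tauto

/-- A minimum spanning forest of a symmetric disk graph weighs at most `2 log n` times any
connected graph on the same points. -/
lemma graphWeight_le_two_mul_log_mul {V : Type*} [Fintype V] [MetricSpace V] {r : V → ℝ}
    {F T : SimpleGraph V} (hF : IsMSF (edgeWeight V) (sdg r) F) (hT : T.Connected) :
    graphWeight (edgeWeight V) F
      ≤ 2 * Real.log (Fintype.card V) * graphWeight (edgeWeight V) T := by
  classical
  have hT0 : 0 ≤ graphWeight (edgeWeight V) T := Finset.sum_nonneg fun e _ => edgeWeight_nonneg e
  have hsum : graphWeight (edgeWeight V) F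
      ≤ 2 * graphWeight (edgeWeight V) T * Real.log (F.edgeFinset.card + 1) := by
    refine le_of_eq_of_le (by unfold graphWeight; congr!)
      (sum_le_mul_log_card (edgeWeight V) (by positivity) F.edgeFinset ?_
        fun e _ => edgeWeight_nonneg e)
    intro e he
    have hpoint : ∃ v, edgeWeight V e ≤ r v := by
      induction e with | h a b => exact ⟨a, (hF.1.1 (mem_edgeFinset.mp he)).2.1⟩
    obtain ⟨N, hcard, hN⟩ := exists_separated_of_isMSF_sdg hF hpoint
    -- The edge `e` counts itself, so `N` has the two points the packing bound needs.
    have hpos : 0 < (F.edgeFinset.filter fun e' => edgeWeight V e ≤ edgeWeight V e').card :=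
      Finset.card_pos.mpr ⟨e, Finset.mem_filter.mpr ⟨he, le_rfl⟩⟩
    have hcard' : N.card
        = (F.edgeFinset.filter fun e' => edgeWeight V e ≤ edgeWeight V e').card + 1 := by
      rw [hcard]
    have h := card_mul_le_graphWeight hT (edgeWeight_nonneg e) N hN (by omega)
    rw [hcard'] at h
    push_cast at h
    linarith
  have hedges : F.edgeFinset.card + 1 ≤ Fintype.card V := by
    have := hT.nonempty
    -- Deleting every edge bounds the number of forest edges by `n - 1`.
    obtain ⟨N, -, hcard, -⟩ := exists_separated_endpoints hF.1.2.1 Set.univ_nonempty F.edgeFinset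
      (fun e he => mem_edgeFinset.mp he) (fun _ _ _ _ => Set.mem_univ _)
    exact hcard ▸ N.card_le_univ
  have hlog : Real.log (F.edgeFinset.card + 1) ≤ Real.log (Fintype.card V) :=
    Real.log_le_log (by positivity) (by exact_mod_cast hedges)
  calc graphWeight (edgeWeight V) F
      ≤ 2 * graphWeight (edgeWeight V) T * Real.log (F.edgeFinset.card + 1) := hsum
    _ ≤ 2 * graphWeight (edgeWeight V) T * Real.log (Fintype.card V) := by gcongr
    _ = _ := by ring

end MetricMSF

theorem theorem1 {V : Type*} [Fintype V] [Nonempty V] [MetricSpace V]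
    (r : V → ℝ) (hr : ∀ v, 0 ≤ r v) (F T : SimpleGraph V)
    (hF : MetricMSF.IsMSF (MetricMSF.edgeWeight V) (MetricMSF.sdg r) F)
    (hT : MetricMSF.IsMST (MetricMSF.edgeWeight V) (⊤ : SimpleGraph V) T) :
    MetricMSF.graphWeight (MetricMSF.edgeWeight V) F ≤
      2 * Real.logb (5 / 4) (Fintype.card V : ℝ) *
        MetricMSF.graphWeight (MetricMSF.edgeWeight V) T := by
  have hT0 : 0 ≤ MetricMSF.graphWeight (MetricMSF.edgeWeight V) T :=
    Finset.sum_nonneg fun e _ => MetricMSF.edgeWeight_nonneg e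
  refine (MetricMSF.graphWeight_le_two_mul_log_mul hF hT.1.2.connected).trans ?_
  gcongr
  have hcard : (1 : ℝ) ≤ Fintype.card V := by exact_mod_cast Fintype.card_pos
  -- Base `5 / 4` is weaker than the natural logarithm, since `log (5 / 4) ≤ 1`.
  have hbase : Real.log (5 / 4) ≤ 1 := by
    have := Real.log_le_sub_one_of_pos (x := 5 / 4) (by norm_num)
    linarith
  exact le_div_self (Real.log_nonneg hcard) (Real.log_pos (by norm_num)) hbase
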